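/- In preemptive machine minimization, an instance is a finite set $J$ of jobs, where each job $j$ has a release date $r_j\in\mathbb N$, a deadline $d_j\in\mathbb N$ and a processing time $p_j\in\mathbb N$. A feasible schedule of $J$ on $k$ machines processes every job $j\in J$ for exactly $p_j$ units of time within its window $[r_j,d_j)$; each machine processes at most one job at any time, and no job runs on two machines at the same time. A job may be preempted at any (real) moment in time, and it may resume later on the same or on any other machine; a schedule changes its decisions at finitely many points in time only. The optimum of $J$ is the minimum number $m$ of machines on which $J$ has a feasible schedule. An online algorithm is not given $m$, and each job becomes known to it only at the job's release date: its decisions at time $t$ depend only on the jobs $j$ with $r_j\le t$. **Theorem.** There are a deterministic online algorithm $\mathsf A$ and a function $\rho:\mathbb N\to\mathbb R$ with $\rho(m)=\mathcal O(m^2\log m)$ as $m\to\infty$ such that, for every instance $J$ that admits a feasible schedule, $\mathsf A$ produces a feasible schedule of $J$ on at most $\rho(m)\cdot m$ machines, where $m$ is the optimum of $J$. In particular, $\mathsf A$ is $\mathcal O(1)$-competitive whenever $m$ is bounded: for every $M$ there is a constant $c$ such that $\mathsf A$ produces a feasible schedule on at most $c\cdot m$ machines for every instance whose optimum $m$ satisfies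 $m\le M$. -/

import Mathlib

open Filter Asymptotics MeasureTheory

namespace MachineMinimization

/-- A job: a label `id` (so that an instance may contain several jobs with the same data), a
release date, a deadline and a processing time. -/
@[ext]
structure Job where
  id : ℕ
  release : ℕ
  deadline : ℕ
  proc : ℕ

/-- A problem instance: a finite set of (labelled) jobs. -/
abbrev Instance := Finset Job

/-- The jobs of `J` that are released at or before time `t`. -/
noncomputable def releasedBy (J : Instance) (t : ℝ) : Instance :=
  J.filter (fun j => (j.release : ℝ) ≤ t)

/-- A schedule tells for every machine `i : ℕ` and every time `t : ℝ` which job, if any,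
machine `i` processes at time `t`. In particular a machine processes at most one job at a time. -/
abbrev Schedule := ℕ → ℝ → Option Job

/-- The set of times at which job `j` is processed (on whatever machine). -/
def Schedule.runTimes (σ : Schedule) (j : Job) : Set ℝ :=
  {t | ∃ i, σ i t = some j}

/-- `σ` is a feasible preemptive schedule (with migration) of `J` on the `k` machines
`0, …, k - 1`. -/
structure IsFeasible (J : Instance) (k : ℕ) (σ : Schedule) : Prop where
  /-- Only the machines `0, …, k - 1` are used. -/
  machines : ∀ i t, k ≤ i → σ i t = none
  /-- Only jobs of the instance are processed. -/
  mem : ∀ i t j, σ i t = some j → j ∈ J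
  /-- A job is processed only within its time window `[release, deadline)`. -/
  window : ∀ i t j, σ i t = some j → (j.release : ℝ) ≤ t ∧ t < (j.deadline : ℝ)
  /-- No job runs on two machines at the same time. -/
  no_parallel : ∀ i i' t j, σ i t = some j → σ i' t = some j → i = i'
  /-- Decisions change at finitely many (real) points in time only: they are constant on each
  half-open interval between consecutive breakpoints. -/
  breakpoints : ∃ P : Finset ℝ, ∀ i s t, s ≤ t → (∀ p ∈ P, ¬ (s < p ∧ p ≤ t)) → σ i s = σ i t
  /-- Every job is processed for exactly its processing time. -/
  processed : ∀ j ∈ J, volume (σ.runTimes j) = (j.proc : ENNReal)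

/-- `m` is the optimal offline number of machines for `J`: the least number of machines on which
`J` has a feasible schedule. (An instance without any feasible schedule has no optimum.) -/
def IsOptimum (J : Instance) (m : ℕ) : Prop :=
  IsLeast {k : ℕ | ∃ σ : Schedule, IsFeasible J k σ} m

/-- A (deterministic) online algorithm produces a schedule for every instance, without knowing the
future: its decisions at time `t` depend only on the jobs released at or before time `t`. -/
structure OnlineAlgorithm where
  schedule : Instance → Schedule
  online : ∀ (J J' : Instance) (t : ℝ), releasedBy J t = releasedBy J' t →
    ∀ i, schedule J i t = schedule J' i t

end MachineMinimization

namespace MachineMinimization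

open scoped Classical

/-! Release dates and deadlines are integers, so only the work done per unit slot matters: a
feasible schedule on m machines yields a `FracSchedule`, and every bound used below comes from it.
The online algorithm assigns whole slots. It treats loose jobs (processing time at most half the
window) and tight jobs separately.

Loose jobs run under EDF on 20m machines. On the jobs with deadline at most d, EDF at time t is
behind the fractional schedule by at most 4m(d - t) (`edf_lag_le`), hence by nothing at t = d.

An active tight job runs until it is finished, except in slots where it is blocked. Let k = 300m².
While more than k active jobs remain, one of them is blocked, and the slot is charged to the rank of
that job in a sorted chain of k + 1 active jobs. The laxity of a job is divided equally among the k
+ 1 ranks, so each job keeps enough slots. Blocking can only get stuck at a chain in which each job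
has spent its budget at its own rank. Tracing back the slots where budgets were spent (`Explains`)
gives a set T of slots, each lying in k + 1 windows of jobs whose laxity is at most (k + 1)|window ∩
T|.

`not_critical` rules this out. Peel off layers of jobs that cover all that is still covered, but no
slot more than twice. By tightness, the set X still covered after 2m + 1 layers has at least 4(k +
1)|T| slots. Each of these first layers covers X and has total laxity at most 2(k + 1)|T|, so it
needs |X|/2 units of processing inside X. Together they need more than m|X|.

As m is unknown, jobs are grouped by the fractional optimum at their release (`jobClass`). Each
class i ≤ m has its own machines, O(m²) of them, which gives 640m³ in total; the logarithm in the
required bound is not needed. -/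

/-- Jobs are ordered lexicographically, by release date first. -/
noncomputable instance : LinearOrder Job :=
  LinearOrder.lift'
    (fun j : Job => (toLex (j.release, toLex (j.deadline, toLex (j.proc, j.id))) :
      ℕ ×ₗ ℕ ×ₗ ℕ ×ₗ ℕ))
    (by
      intro i j h
      simp only [EmbeddingLike.apply_eq_iff_eq, Prod.mk.injEq] at h
      ext <;> tauto)

theorem Job.release_le_of_lt {i j : Job} (h : i < j) : i.release ≤ j.release := by
  have h' : (toLex (i.release, toLex (i.deadline, toLex (i.proc, i.id))) :
      ℕ ×ₗ ℕ ×ₗ ℕ ×ₗ ℕ) < toLex (j.release, toLex (j.deadline, toLex (j.proc, j.id))) := h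
  rw [Prod.Lex.toLex_lt_toLex] at h'
  rcases h' with h' | h'
  · exact h'.le
  · exact h'.1.le

/-! ### Fractional schedules on unit slots -/

/-- The unit time slots `[s, s + 1)` in the time window of a job. -/
def Job.window (j : Job) : Finset ℕ := Finset.Ico j.release j.deadline

theorem Job.mem_window {j : Job} {s : ℕ} : s ∈ j.window ↔ j.release ≤ s ∧ s < j.deadline :=
  Finset.mem_Ico

/-- `y j s` is the amount of processing that job `j` receives in slot `s` in some schedule of `J`
on `m` machines. -/
structure FracSchedule (J : Instance) (m : ℕ) (y : Job → ℕ → ℝ) : Prop where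
  nonneg : ∀ j s, 0 ≤ y j s
  le_one : ∀ j s, y j s ≤ 1
  outside : ∀ j ∈ J, ∀ s, s ∉ j.window → y j s = 0
  load : ∀ s, ∑ j ∈ J, y j s ≤ m
  total : ∀ j ∈ J, ∑ s ∈ j.window, y j s = j.proc

namespace FracSchedule

variable {J : Instance} {m : ℕ} {y : Job → ℕ → ℝ}

theorem subset (h : FracSchedule J m y) {J' : Instance} (hJ : J' ⊆ J) : FracSchedule J' m y where
  nonneg := h.nonneg
  le_one := h.le_one
  outside j hj := h.outside j (hJ hj)
  load s := (Finset.sum_le_sum_of_subset_of_nonneg hJ fun j _ _ => h.nonneg j s).trans (h.load s)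
  total j hj := h.total j (hJ hj)

theorem sum_le_proc (h : FracSchedule J m y) {j : Job} (hj : j ∈ J) (X : Finset ℕ) :
    ∑ s ∈ X, y j s ≤ j.proc := by
  rw [← h.total j hj, ← Finset.sum_subset (Finset.inter_subset_left (s₁ := X) (s₂ := j.window))]
  · exact Finset.sum_le_sum_of_subset_of_nonneg Finset.inter_subset_right fun s _ _ => h.nonneg j s
  · intro s hs hs'
    exact h.outside j hj s fun hw => hs' (Finset.mem_inter.2 ⟨hs, hw⟩)

theorem proc_le_card (h : FracSchedule J m y) {j : Job} (hj : j ∈ J) :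
    j.proc ≤ j.window.card := by
  have h1 : (j.proc : ℝ) ≤ j.window.card := by
    rw [← h.total j hj]
    simpa using Finset.sum_le_card_nsmul j.window (y j) 1 fun s _ => h.le_one j s
  exact_mod_cast h1

theorem sum_load_le (h : FracSchedule J m y) {L : Finset Job} (hL : L ⊆ J) (X : Finset ℕ) :
    ∑ j ∈ L, ∑ s ∈ X, y j s ≤ m * X.card := by
  rw [Finset.sum_comm]
  have := Finset.sum_le_card_nsmul X (fun s => ∑ j ∈ L, y j s) m fun s _ => (h.subset hL).load s
  simpa [mul_comm] using this

/-- The contribution of a job to a set of slots is bounded below by means of its laxity. -/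
theorem sum_contribution_le (h : FracSchedule J m y) {L : Finset Job} (hL : L ⊆ J)
    (X : Finset ℕ) :
    ∑ j ∈ L, (((j.window ∩ X).card : ℝ) - ((j.window.card : ℝ) - j.proc)) ≤ m * X.card := by
  refine le_trans (Finset.sum_le_sum fun j hj => ?_) (h.sum_load_le hL X)
  have h1 : ∑ s ∈ j.window ∩ X, y j s ≤ ∑ s ∈ X, y j s :=
    Finset.sum_le_sum_of_subset_of_nonneg Finset.inter_subset_right fun s _ _ => h.nonneg j s
  have h2 : ∑ s ∈ j.window \ X, y j s ≤ (j.window \ X).card := by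
    simpa using Finset.sum_le_card_nsmul (j.window \ X) (y j) 1 fun s _ => h.le_one j s
  have h3 := Finset.sum_inter_add_sum_sdiff j.window X (y j)
  have h4 : ((j.window ∩ X).card : ℝ) + (j.window \ X).card = j.window.card := by
    exact_mod_cast Finset.card_inter_add_card_sdiff j.window X
  have h5 := h.total j (hL hj)
  linarith

theorem sum_proc_le (h : FracSchedule J m y) {L : Finset Job} (hL : L ⊆ J) {X : Finset ℕ}
    (hX : ∀ j ∈ L, j.window ⊆ X) : ∑ j ∈ L, (j.proc : ℝ) ≤ m * X.card := by
  refine le_trans (Finset.sum_le_sum fun j hj => ?_) (h.sum_contribution_le hL X)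
  rw [Finset.inter_eq_left.2 (hX j hj)]
  linarith

end FracSchedule

/-! ### From feasible schedules to fractional ones -/

/-- Off the finitely many breakpoints decisions are locally constant, so the set is open up to a
finite set. -/
theorem IsFeasible.measurableSet {J : Instance} {k : ℕ} {σ : Schedule} (h : IsFeasible J k σ)
    (i : ℕ) (j : Job) : MeasurableSet {t | σ i t = some j} := by
  obtain ⟨P, hP⟩ := h.breakpoints
  have hopen : IsOpen ({t | σ i t = some j} \ (P : Set ℝ)) := by
    rw [Metric.isOpen_iff]
    rintro t ⟨ht, htP⟩
    obtain ⟨ε, hε, hb⟩ := Metric.isOpen_iff.1 P.finite_toSet.isClosed.isOpen_compl t htP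
    refine ⟨ε, hε, fun s hs => ⟨?_, hb hs⟩⟩
    rw [Real.ball_eq_Ioo] at hb hs
    have hc : σ i s = σ i t := by
      rcases le_total s t with hst | hst
      · refine hP i s t hst fun p hp hps => hb ⟨hs.1.trans hps.1, ?_⟩ hp
        linarith [hps.2]
      · refine (hP i t s hst fun p hp hps => hb ⟨?_, hps.2.trans_lt hs.2⟩ hp).symm
        linarith [hps.1]
    exact hc.trans ht
  rw [← Set.sdiff_union_inter {t | σ i t = some j} (P : Set ℝ)]
  exact hopen.measurableSet.union ((P.finite_toSet.subset Set.inter_subset_right).measurableSet)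

theorem IsFeasible.measurableSet_runTimes {J : Instance} {k : ℕ} {σ : Schedule}
    (h : IsFeasible J k σ) (j : Job) : MeasurableSet (σ.runTimes j) := by
  have : σ.runTimes j = ⋃ i, {t | σ i t = some j} := by ext t; simp [Schedule.runTimes]
  rw [this]
  exact MeasurableSet.iUnion fun i => h.measurableSet i j

theorem IsFeasible.sum_volume_le {J : Instance} {k : ℕ} {σ : Schedule} (h : IsFeasible J k σ)
    {I : Set ℝ} (hI : MeasurableSet I) :
    ∑ j ∈ J, volume (σ.runTimes j ∩ I) ≤ k * volume I := by
  have h1 : ∀ j, volume (σ.runTimes j ∩ I) ≤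
      ∑ i ∈ Finset.range k, volume ({t | σ i t = some j} ∩ I) := by
    intro j
    refine le_trans (measure_mono ?_) (measure_biUnion_finset_le (Finset.range k)
      fun i => {t | σ i t = some j} ∩ I)
    rintro t ⟨⟨i, hi⟩, ht⟩
    have hik : i < k := by
      by_contra hik
      rw [h.machines i t (not_lt.1 hik)] at hi
      cases hi
    exact Set.mem_biUnion (Finset.mem_coe.2 (Finset.mem_range.2 hik)) ⟨hi, ht⟩
  refine (Finset.sum_le_sum fun j _ => h1 j).trans ?_
  rw [Finset.sum_comm]
  have h2 : ∀ i ∈ Finset.range k, ∑ j ∈ J, volume ({t | σ i t = some j} ∩ I) ≤ volume I := by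
    intro i _
    rw [← measure_biUnion_finset]
    · exact measure_mono (Set.iUnion₂_subset fun j _ => Set.inter_subset_right)
    · intro a _ b _ hab
      refine Set.disjoint_left.2 fun t ha hb => hab ?_
      exact Option.some_injective _ (ha.1.symm.trans hb.1)
    · exact fun j _ => (h.measurableSet i j).inter hI
  simpa using Finset.sum_le_card_nsmul _ _ _ h2

/-- Windows are unions of unit slots, so measuring the run times slot by slot loses nothing. -/
theorem IsFeasible.exists_fracSchedule {J : Instance} {k : ℕ} {σ : Schedule}
    (h : IsFeasible J k σ) : ∃ y, FracSchedule J k y := by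
  have hvol : ∀ s : ℕ, volume (Set.Ico (s : ℝ) (s + 1)) = 1 := by intro s; simp
  have hle : ∀ j s, volume (σ.runTimes j ∩ Set.Ico ((s : ℕ) : ℝ) (s + 1)) ≤ 1 := fun j s =>
    (measure_mono Set.inter_subset_right).trans (hvol s).le
  have hfin : ∀ j s, volume (σ.runTimes j ∩ Set.Ico ((s : ℕ) : ℝ) (s + 1)) ≠ ⊤ := fun j s =>
    ne_top_of_le_ne_top ENNReal.one_ne_top (hle j s)
  refine ⟨fun j s => (volume (σ.runTimes j ∩ Set.Ico (s : ℝ) (s + 1))).toReal, ?_, ?_, ?_, ?_, ?_⟩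
  · exact fun _ _ => ENNReal.toReal_nonneg
  · exact fun j s => ENNReal.toReal_le_of_le_ofReal zero_le_one (by simpa using hle j s)
  · intro j _ s hs
    have : σ.runTimes j ∩ Set.Ico (s : ℝ) (s + 1) = ∅ := by
      refine Set.eq_empty_iff_forall_notMem.2 ?_
      rintro t ⟨⟨i, hi⟩, h1, h2⟩
      obtain ⟨h3, h4⟩ := h.window i t j hi
      have h5 : (j.release : ℝ) < s + 1 := h3.trans_lt h2
      have h6 : (s : ℝ) < j.deadline := h1.trans_lt h4
      refine hs (Job.mem_window.2 ⟨?_, by exact_mod_cast h6⟩)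
      have : j.release < s + 1 := by exact_mod_cast h5
      omega
    simp [this]
  · intro s
    rw [← ENNReal.toReal_sum fun j _ => hfin j s]
    refine ENNReal.toReal_le_of_le_ofReal (Nat.cast_nonneg k) ?_
    refine (h.sum_volume_le measurableSet_Ico).trans ?_
    rw [hvol, mul_one, ENNReal.ofReal_natCast]
  · intro j hj
    rw [← ENNReal.toReal_sum fun s _ => hfin j s, ← measure_biUnion_finset]
    · have : ⋃ s ∈ j.window, σ.runTimes j ∩ Set.Ico (s : ℝ) (s + 1) = σ.runTimes j := by
        refine Set.Subset.antisymm (Set.iUnion₂_subset fun s _ => Set.inter_subset_left) ?_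
        rintro t ⟨i, hi⟩
        obtain ⟨h3, h4⟩ := h.window i t j hi
        have h0 : 0 ≤ t := (Nat.cast_nonneg _).trans h3
        refine Set.mem_biUnion (Finset.mem_coe.2 (Job.mem_window.2 ⟨Nat.le_floor h3, ?_⟩))
          ⟨⟨i, hi⟩, Nat.floor_le h0, Nat.lt_floor_add_one t⟩
        exact (Nat.floor_lt h0).2 h4
      rw [this, h.processed j hj, ENNReal.toReal_natCast]
    · intro a _ b _ hab
      refine Set.disjoint_left.2 fun t ha hb => hab ?_
      have h1 : (a : ℝ) < b + 1 := ha.2.1.trans_lt hb.2.2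
      have h2 : (b : ℝ) < a + 1 := hb.2.1.trans_lt ha.2.2
      have h3 : a < b + 1 := by exact_mod_cast h1
      have h4 : b < a + 1 := by exact_mod_cast h2
      omega
    · exact fun s _ => (h.measurableSet_runTimes j).inter measurableSet_Ico

/-! ### Loose jobs: EDF -/

theorem exists_earliest (k : ℕ) (A : Finset Job) : ∃ S ⊆ A, S.card ≤ k ∧
    ∀ i ∈ A, i ∉ S → S.card = k ∧ ∀ j ∈ S, j.deadline ≤ i.deadline := by
  induction k with
  | zero => exact ⟨∅, by simp⟩
  | succ k ih =>
    obtain ⟨S, hSA, hS, h⟩ := ih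
    rcases (A \ S).eq_empty_or_nonempty with h0 | h0
    · refine ⟨S, hSA, by omega, fun i hi hiS => ?_⟩
      exact absurd (Finset.mem_sdiff.2 ⟨hi, hiS⟩) (by simp [h0])
    · obtain ⟨i₀, hi₀, hmin⟩ := Finset.exists_min_image (A \ S) Job.deadline h0
      rw [Finset.mem_sdiff] at hi₀
      have hk := (h i₀ hi₀.1 hi₀.2).1
      have hcard : (insert i₀ S).card = k + 1 := by rw [Finset.card_insert_of_notMem hi₀.2, hk]
      refine ⟨insert i₀ S, Finset.insert_subset hi₀.1 hSA, hcard.le, fun i hi hiS => ⟨hcard, ?_⟩⟩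
      rw [Finset.mem_insert, not_or] at hiS
      intro j hj
      rcases Finset.mem_insert.1 hj with rfl | hj
      · exact hmin i (Finset.mem_sdiff.2 ⟨hi, hiS.2⟩)
      · exact (h i hi hiS.2).2 j hj

/-- A set of `k` jobs with earliest deadlines among the jobs of `A` (or all of `A`). -/
noncomputable def earliest (k : ℕ) (A : Finset Job) : Finset Job := (exists_earliest k A).choose

theorem earliest_subset (k : ℕ) (A : Finset Job) : earliest k A ⊆ A :=
  (exists_earliest k A).choose_spec.1

theorem card_earliest_le (k : ℕ) (A : Finset Job) : (earliest k A).card ≤ k :=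
  (exists_earliest k A).choose_spec.2.1

theorem earliest_spec {k : ℕ} {A : Finset Job} {i : Job} (hi : i ∈ A) (hi' : i ∉ earliest k A) :
    (earliest k A).card = k ∧ ∀ j ∈ earliest k A, j.deadline ≤ i.deadline :=
  (exists_earliest k A).choose_spec.2.2 i hi hi'

/-- The number of slots before slot `n` in which EDF on `k` machines processes a job. -/
noncomputable def edfDone (k : ℕ) (J : Instance) : ℕ → Job → ℕ
  | 0, _ => 0
  | n + 1, j => edfDone k J n j +
      if j ∈ earliest k ((J.filter (·.release ≤ n)).filter fun i => edfDone k J n i < i.proc)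
      then 1 else 0

/-- The set of jobs that EDF (earliest deadline first) on `k` machines processes in slot `n`. -/
noncomputable def edf (k : ℕ) (J : Instance) (n : ℕ) : Finset Job :=
  earliest k ((J.filter (·.release ≤ n)).filter fun i => edfDone k J n i < i.proc)

theorem edfDone_succ (k : ℕ) (J : Instance) (n : ℕ) (j : Job) :
    edfDone k J (n + 1) j = edfDone k J n j + if j ∈ edf k J n then 1 else 0 := rfl

theorem edfDone_congr {k : ℕ} {J J' : Instance} {n : ℕ}
    (h : ∀ s < n, J.filter (·.release ≤ s) = J'.filter (·.release ≤ s)) :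
    edfDone k J n = edfDone k J' n := by
  induction n with
  | zero => rfl
  | succ n ih =>
    ext j
    rw [edfDone_succ, edfDone_succ, edf, edf, ih fun s hs => h s (by omega), h n (by omega)]

theorem filter_release_congr {J J' : Instance} {n s : ℕ} (hs : s ≤ n)
    (h : J.filter (·.release ≤ n) = J'.filter (·.release ≤ n)) :
    J.filter (·.release ≤ s) = J'.filter (·.release ≤ s) := by
  ext j
  have := Finset.ext_iff.1 h j
  simp only [Finset.mem_filter] at this ⊢
  constructor
  · exact fun hj => ⟨(this.1 ⟨hj.1, hj.2.trans hs⟩).1, hj.2⟩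
  · exact fun hj => ⟨(this.2 ⟨hj.1, hj.2.trans hs⟩).1, hj.2⟩

theorem edf_congr {k : ℕ} {J J' : Instance} {n : ℕ}
    (h : J.filter (·.release ≤ n) = J'.filter (·.release ≤ n)) : edf k J n = edf k J' n := by
  rw [edf, edf, h, edfDone_congr fun s hs => filter_release_congr hs.le h]

theorem mem_edf {k : ℕ} {J : Instance} {n : ℕ} {j : Job} (h : j ∈ edf k J n) :
    j ∈ J ∧ j.release ≤ n ∧ edfDone k J n j < j.proc := by
  have := earliest_subset _ _ h
  simp only [Finset.mem_filter] at this
  tauto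

theorem edfDone_le {k : ℕ} {J : Instance} {n : ℕ} {j : Job} : edfDone k J n j ≤ j.proc := by
  induction n with
  | zero => exact Nat.zero_le _
  | succ n ih =>
    rw [edfDone_succ]
    split_ifs with h
    · exact (mem_edf h).2.2
    · exact ih

theorem edfDone_mono {k : ℕ} {J : Instance} {j : Job} : Monotone fun n => edfDone k J n j :=
  monotone_nat_of_le_succ fun n => by simp [edfDone_succ]

theorem edfDone_eq_card (k : ℕ) (J : Instance) (n : ℕ) (j : Job) :
    edfDone k J n j = ((Finset.range n).filter fun s => j ∈ edf k J s).card := by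
  induction n with
  | zero => rfl
  | succ n ih =>
    rw [edfDone_succ, ih, Finset.range_add_one, Finset.filter_insert]
    split_ifs
    · rw [Finset.card_insert_of_notMem (by simp)]
    · rfl

/-- While a job `j` is unfinished, EDF processes jobs with deadline at most `d`, where
`j.deadline ≤ d`, on all machines whenever it does not process `j`. -/
theorem le_sum_edfDone {k : ℕ} {J : Instance} {d t : ℕ} {j : Job} (hj : j ∈ J)
    (hd : j.deadline ≤ d) (ht : j.release ≤ t) (hun : edfDone k J t j < j.proc) :
    (k : ℝ) * ((t : ℝ) - j.release - j.proc) ≤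
      ∑ i ∈ J.filter (·.deadline ≤ d), (edfDone k J t i : ℝ)
        - ∑ i ∈ J.filter (·.deadline ≤ d), (edfDone k J j.release i : ℝ) := by
  have key : ∀ t, j.release ≤ t → edfDone k J t j < j.proc →
      (k : ℝ) * ((t : ℝ) - j.release - (edfDone k J t j - edfDone k J j.release j)) ≤
      ∑ i ∈ J.filter (·.deadline ≤ d), (edfDone k J t i : ℝ)
        - ∑ i ∈ J.filter (·.deadline ≤ d), (edfDone k J j.release i : ℝ) := by
    intro t ht
    induction t, ht using Nat.le_induction with
    | base => intro _; simp
    | succ t ht ih =>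
      intro hun
      have hun' : edfDone k J t j < j.proc := (edfDone_mono (Nat.le_succ t)).trans_lt hun
      have ih := ih hun'
      have hsum : ∑ i ∈ J.filter (·.deadline ≤ d), (edfDone k J (t + 1) i : ℝ) =
          ∑ i ∈ J.filter (·.deadline ≤ d), (edfDone k J t i : ℝ) +
            (((J.filter (·.deadline ≤ d)).filter (· ∈ edf k J t)).card : ℝ) := by
        simp only [edfDone_succ]
        push_cast
        rw [Finset.sum_add_distrib, Finset.sum_boole]
      rw [hsum, edfDone_succ]
      split_ifs with hmem
      · push_cast
        have : (0 : ℝ) ≤ ((J.filter (·.deadline ≤ d)).filter (· ∈ edf k J t)).card :=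
          Nat.cast_nonneg _
        linarith
      · have hcand : j ∈ (J.filter (·.release ≤ t)).filter fun i => edfDone k J t i < i.proc := by
          simp [hj, ht, hun']
        obtain ⟨h1, h2⟩ := earliest_spec hcand hmem
        have h3 : edf k J t ⊆ (J.filter (·.deadline ≤ d)).filter (· ∈ edf k J t) := by
          intro i hi
          simp only [Finset.mem_filter]
          exact ⟨⟨(mem_edf hi).1, (h2 i hi).trans hd⟩, hi⟩
        have h4 : (k : ℝ) ≤ ((J.filter (·.deadline ≤ d)).filter (· ∈ edf k J t)).card := by
          exact_mod_cast h1.symm.le.trans (Finset.card_le_card h3)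
        push_cast
        linarith
  refine le_trans (mul_le_mul_of_nonneg_left ?_ (Nat.cast_nonneg k)) (key t ht hun)
  have h1 : (edfDone k J t j : ℝ) ≤ j.proc := by exact_mod_cast hun.le
  have h2 : (0 : ℝ) ≤ edfDone k J j.release j := Nat.cast_nonneg _
  linarith

/-- EDF never lags behind an optimal schedule by much, if all jobs are loose. -/
theorem edf_lag_le {J : Instance} {m : ℕ} {y : Job → ℕ → ℝ} (h : FracSchedule J m y)
    (hloose : ∀ j ∈ J, j.release + 2 * j.proc ≤ j.deadline) {d t : ℕ} (htd : t ≤ d) :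
    ∑ j ∈ J.filter (·.deadline ≤ d), (∑ s ∈ Finset.range t, y j s - edfDone (20 * m) J t j) ≤
      4 * m * ((d : ℝ) - t) := by
  induction t using Nat.strong_induction_on with
  | _ t ih =>
  by_contra! hlag
  have htd' : (t : ℝ) ≤ d := by exact_mod_cast htd
  -- If an unfinished job was released at r with d - r ≥ 4(d - t), looseness gives t - r - p ≥ (d -
  -- r)/4, so EDF has done at least 20m(d - r)/4 = 5m(d - r) since r. This pays for the lag at r, at
  -- most 4m(d - r), and for the at most m(d - r) units added by `y`.
  by_cases hold : ∃ j ∈ J.filter (·.deadline ≤ d), j.release < t ∧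
      edfDone (20 * m) J t j < j.proc ∧ 4 * ((d : ℝ) - t) ≤ d - j.release
  · obtain ⟨j, hj, hrt, hun, hfar⟩ := hold
    rw [Finset.mem_filter] at hj
    have h1 := le_sum_edfDone hj.1 hj.2 hrt.le hun
    have h2 := ih j.release hrt (hrt.le.trans htd)
    have h3 : ∑ i ∈ J.filter (·.deadline ≤ d), ∑ s ∈ Finset.range t, y i s ≤
        ∑ i ∈ J.filter (·.deadline ≤ d), ∑ s ∈ Finset.range j.release, y i s +
          m * ((t : ℝ) - j.release) := by
      have h4 := h.sum_load_le (Finset.filter_subset (·.deadline ≤ d) J) (Finset.Ico j.release t)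
      rw [Nat.card_Ico, Nat.cast_sub hrt.le] at h4
      refine le_trans (le_of_eq ?_) (add_le_add_right h4 _)
      rw [← Finset.sum_add_distrib]
      exact Finset.sum_congr rfl fun i _ => (Finset.sum_range_add_sum_Ico (y i) hrt.le).symm
    rw [Finset.sum_sub_distrib] at hlag h2
    have h5 : (j.release : ℝ) + 2 * j.proc ≤ d := by
      exact_mod_cast (hloose j hj.1).trans hj.2
    have h6 : (j.release : ℝ) ≤ t := by exact_mod_cast hrt.le
    push_cast at h1
    have hm : (0 : ℝ) ≤ m := Nat.cast_nonneg m
    nlinarith [mul_nonneg hm (by linarith : (0 : ℝ) ≤ 2 * ((t : ℝ) - j.release - j.proc) -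
      (d - j.release) / 2), mul_nonneg hm (sub_nonneg.2 htd'), mul_nonneg hm (sub_nonneg.2 h6)]
  -- Otherwise every job with positive lag has its window within the last 4(d - t) slots before d,
  -- where `y` can process at most 4m(d - t) units.
  · push Not at hold
    set x := d - t with hx
    have hxr : (d : ℝ) - t = x := by rw [hx, Nat.cast_sub htd]
    have hle : ∑ j ∈ J.filter (·.deadline ≤ d),
        (∑ s ∈ Finset.range t, y j s - edfDone (20 * m) J t j) ≤
        ∑ j ∈ J.filter (·.deadline ≤ d), if d < j.release + 4 * x then (j.proc : ℝ) else 0 := by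
      refine Finset.sum_le_sum fun j hj => ?_
      have hjJ := (Finset.mem_filter.1 hj).1
      have h1 := h.sum_le_proc hjJ (Finset.range t)
      have h2 : (0 : ℝ) ≤ edfDone (20 * m) J t j := Nat.cast_nonneg _
      split_ifs with hc
      · linarith
      · rcases Nat.lt_or_ge j.release t with hrt | hrt
        · have h3 : ¬ edfDone (20 * m) J t j < j.proc := fun hun => hc <| by
            have := hold j hj hrt hun
            rw [hxr] at this
            have h4 : (d : ℝ) < j.release + 4 * x := by linarith
            exact_mod_cast h4
          have h4 : (j.proc : ℝ) ≤ edfDone (20 * m) J t j := by exact_mod_cast not_lt.1 h3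
          linarith
        · have : ∑ s ∈ Finset.range t, y j s = 0 := Finset.sum_eq_zero fun s hs =>
            h.outside j hjJ s fun hw => by
              have := (Job.mem_window.1 hw).1
              have := Finset.mem_range.1 hs
              omega
          linarith
    rw [← Finset.sum_filter] at hle
    have h1 := h.sum_proc_le (L := (J.filter (·.deadline ≤ d)).filter (d < ·.release + 4 * x))
      (X := Finset.Ico (d + 1 - 4 * x) d)
      ((Finset.filter_subset _ _).trans (Finset.filter_subset _ _)) (by
        intro j hj s hs
        simp only [Finset.mem_filter] at hj
        rw [Job.mem_window] at hs
        rw [Finset.mem_Ico]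
        omega)
    have h2 : ((Finset.Ico (d + 1 - 4 * x) d).card : ℝ) ≤ 4 * x := by
      rw [Nat.card_Ico]
      exact_mod_cast (by omega : d - (d + 1 - 4 * x) ≤ 4 * x)
    have h3 := mul_le_mul_of_nonneg_left h2 (Nat.cast_nonneg (α := ℝ) m)
    rw [hxr] at hlag
    linarith

/-- At `t = d` the lag is at most 0, but it is a sum of nonnegative terms, because `y` has completed
all jobs with deadline at most `d`. -/
theorem edf_finishes {J : Instance} {m : ℕ} {y : Job → ℕ → ℝ} (h : FracSchedule J m y)
    (hloose : ∀ j ∈ J, j.release + 2 * j.proc ≤ j.deadline) {j : Job} (hj : j ∈ J) :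
    edfDone (20 * m) J j.deadline j = j.proc := by
  have h1 := edf_lag_le h hloose (le_refl j.deadline)
  rw [sub_self, mul_zero] at h1
  have h2 : ∀ i ∈ J.filter (·.deadline ≤ j.deadline),
      (0 : ℝ) ≤ ∑ s ∈ Finset.range j.deadline, y i s - edfDone (20 * m) J j.deadline i := by
    intro i hi
    rw [Finset.mem_filter] at hi
    have h3 : ∑ s ∈ i.window, y i s ≤ ∑ s ∈ Finset.range j.deadline, y i s := by
      refine Finset.sum_le_sum_of_subset_of_nonneg (fun s hs => ?_) fun s _ _ => h.nonneg i s
      exact Finset.mem_range.2 ((Job.mem_window.1 hs).2.trans_le hi.2)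
    rw [h.total i hi.1] at h3
    have h4 : (edfDone (20 * m) J j.deadline i : ℝ) ≤ i.proc := by exact_mod_cast edfDone_le
    linarith
  have hj' : j ∈ J.filter (·.deadline ≤ j.deadline) := by simp [hj]
  have h3 := (Finset.single_le_sum h2 hj').trans h1
  have h4 : ∑ s ∈ j.window, y j s ≤ ∑ s ∈ Finset.range j.deadline, y j s :=
    Finset.sum_le_sum_of_subset_of_nonneg
      (fun s hs => Finset.mem_range.2 (Job.mem_window.1 hs).2) fun s _ _ => h.nonneg j s
  rw [h.total j hj] at h4
  refine le_antisymm edfDone_le ?_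
  have : (j.proc : ℝ) ≤ edfDone (20 * m) J j.deadline j := by linarith
  exact_mod_cast this

/-! ### Peeling a family of windows into thin layers -/

/-- In a minimal subcover, no three windows share a slot: the one with the earliest release and the
one with the latest deadline would cover the third. -/
theorem exists_thin (G : Finset Job) : ∃ L ⊆ G, G.biUnion Job.window ⊆ L.biUnion Job.window ∧
    ∀ s, (L.filter (s ∈ ·.window)).card ≤ 2 := by
  obtain ⟨L, hL, hmin⟩ := Finset.exists_min_image
    (G.powerset.filter fun L => G.biUnion Job.window ⊆ L.biUnion Job.window) Finset.card
    ⟨G, Finset.mem_filter.2 ⟨Finset.mem_powerset_self G, subset_rfl⟩⟩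
  simp only [Finset.mem_filter, Finset.mem_powerset] at hL hmin
  refine ⟨L, hL.1, hL.2, fun s => ?_⟩
  by_contra! hs
  set F := L.filter (s ∈ ·.window) with hF
  have hne : F.Nonempty := Finset.card_pos.1 (by omega)
  obtain ⟨a, ha, hamin⟩ := Finset.exists_min_image F Job.release hne
  obtain ⟨b, hb, hbmax⟩ := Finset.exists_max_image F Job.deadline hne
  have h1 : ((F.erase a).erase b).Nonempty := by
    refine Finset.card_pos.1 ?_
    have h2 := Finset.pred_card_le_card_erase (s := F) (a := a)
    have h3 := Finset.pred_card_le_card_erase (s := F.erase a) (a := b)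
    omega
  obtain ⟨c, hc⟩ := h1
  simp only [Finset.mem_erase] at hc
  obtain ⟨hcb, hca, hc⟩ := hc
  have h1a := hamin c hc
  have h1b := hbmax c hc
  simp only [hF, Finset.mem_filter, Job.mem_window] at ha hb hc
  have hcov : G.biUnion Job.window ⊆ (L.erase c).biUnion Job.window := by
    intro t ht
    obtain ⟨i, hi, hit⟩ := Finset.mem_biUnion.1 (hL.2 ht)
    by_cases hic : i = c
    · subst hic
      rw [Job.mem_window] at hit
      rcases le_total t s with hts | hts
      · exact Finset.mem_biUnion.2 ⟨a, Finset.mem_erase.2 ⟨fun h => hca h.symm, ha.1⟩,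
          Job.mem_window.2 ⟨by omega, by omega⟩⟩
      · exact Finset.mem_biUnion.2 ⟨b, Finset.mem_erase.2 ⟨fun h => hcb h.symm, hb.1⟩,
          Job.mem_window.2 ⟨by omega, by omega⟩⟩
    · exact Finset.mem_biUnion.2 ⟨i, Finset.mem_erase.2 ⟨hic, hi⟩, hit⟩
  have h2 := hmin (L.erase c) ⟨(Finset.erase_subset _ _).trans hL.1, hcov⟩
  have h3 := Finset.card_erase_lt_of_mem hc.1
  omega

/-- A subfamily of `G` that covers the same slots as `G`, and every slot at most twice. -/
noncomputable def thin (G : Finset Job) : Finset Job := (exists_thin G).choose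

theorem thin_subset (G : Finset Job) : thin G ⊆ G := (exists_thin G).choose_spec.1

theorem biUnion_window_subset_thin (G : Finset Job) :
    G.biUnion Job.window ⊆ (thin G).biUnion Job.window := (exists_thin G).choose_spec.2.1

theorem card_thin_filter_le (G : Finset Job) (s : ℕ) :
    ((thin G).filter (s ∈ ·.window)).card ≤ 2 := (exists_thin G).choose_spec.2.2 s

/-- What is left of `G` after `n` thin layers have been removed one after the other. -/
noncomputable def peel (G : Finset Job) : ℕ → Finset Job
  | 0 => G
  | n + 1 => peel G n \ thin (peel G n)

theorem peel_antitone (G : Finset Job) : Antitone (peel G) :=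
  antitone_nat_of_succ_le fun _ => Finset.sdiff_subset

theorem peel_subset (G : Finset Job) (n : ℕ) : peel G n ⊆ G := peel_antitone G (Nat.zero_le n)

theorem card_le_card_peel (G : Finset Job) (s n : ℕ) :
    (G.filter (s ∈ ·.window)).card ≤ ((peel G n).filter (s ∈ ·.window)).card + 2 * n := by
  induction n with
  | zero => simp [peel]
  | succ n ih =>
    have h1 : (peel G n).filter (s ∈ ·.window) ⊆
        (peel G (n + 1)).filter (s ∈ ·.window) ∪ (thin (peel G n)).filter (s ∈ ·.window) := by
      intro j hj
      simp only [Finset.mem_filter, Finset.mem_union, peel, Finset.mem_sdiff] at hj ⊢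
      tauto
    have h2 := (Finset.card_le_card h1).trans (Finset.card_union_le _ _)
    have h3 := card_thin_filter_le (peel G n) s
    omega

theorem pairwiseDisjoint_thin_peel (G : Finset Job) (A : Set ℕ) :
    A.PairwiseDisjoint fun n => thin (peel G n) := by
  have key : ∀ a b, a < b → Disjoint (thin (peel G a)) (thin (peel G b)) := by
    intro a b hab
    refine Finset.disjoint_left.2 fun j ha hb => ?_
    have := peel_antitone G (Nat.succ_le_of_lt hab) (thin_subset _ hb)
    exact (Finset.mem_sdiff.1 this).2 ha
  intro a _ b _ hab
  rcases lt_or_gt_of_ne hab with h | h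
  · exact key a b h
  · exact (key b a h).symm

/-- The slots that are covered by what is left of `G` after `n` thin layers have been removed. -/
noncomputable def peelCover (G : Finset Job) (n : ℕ) : Finset ℕ := (peel G n).biUnion Job.window

theorem peelCover_antitone (G : Finset Job) : Antitone (peelCover G) := fun _ _ h =>
  Finset.biUnion_subset_biUnion_of_subset_left _ (peel_antitone G h)

theorem card_le_sum_thin {G : Finset Job} {n : ℕ} {X : Finset ℕ} (hX : X ⊆ peelCover G n) :
    (X.card : ℝ) ≤ ∑ j ∈ thin (peel G n), ((j.window ∩ X).card : ℝ) := by
  have h1 : X ⊆ (thin (peel G n)).biUnion fun j => j.window ∩ X := by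
    intro s hs
    obtain ⟨j, hj, hjs⟩ := Finset.mem_biUnion.1 (biUnion_window_subset_thin _ (hX hs))
    exact Finset.mem_biUnion.2 ⟨j, hj, Finset.mem_inter.2 ⟨hjs, hs⟩⟩
  exact_mod_cast (Finset.card_le_card h1).trans Finset.card_biUnion_le

theorem sum_thin_le (G : Finset Job) (X : Finset ℕ) :
    ∑ j ∈ thin G, ((j.window ∩ X).card : ℝ) ≤ 2 * X.card := by
  have h1 : ∑ j ∈ thin G, (j.window ∩ X).card = ∑ s ∈ X, ((thin G).filter (s ∈ ·.window)).card := by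
    simp only [Finset.card_filter]
    rw [Finset.sum_comm]
    refine Finset.sum_congr rfl fun j _ => ?_
    rw [← Finset.card_filter, Finset.inter_comm, Finset.filter_mem_eq_inter]
  have h2 := Finset.sum_le_card_nsmul X (fun s => ((thin G).filter (s ∈ ·.window)).card) 2
    fun s _ => card_thin_filter_le G s
  rw [← h1, smul_eq_mul, mul_comm] at h2
  exact_mod_cast h2

/-! ### Tight jobs: critical slot sets do not exist -/

namespace FracSchedule

variable {J : Instance} {m : ℕ} {y : Job → ℕ → ℝ}

theorem layers_contribution_le (h : FracSchedule J m y) {G : Finset Job} (hG : G ⊆ J)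
    (X : Finset ℕ) (A : Finset ℕ) :
    ∑ n ∈ A, ∑ j ∈ thin (peel G n),
      (((j.window ∩ X).card : ℝ) - ((j.window.card : ℝ) - j.proc)) ≤ m * X.card := by
  rw [← Finset.sum_biUnion (pairwiseDisjoint_thin_peel G A)]
  refine h.sum_contribution_le (fun j hj => ?_) X
  obtain ⟨n, _, hj⟩ := Finset.mem_biUnion.1 hj
  exact hG (peel_subset G n (thin_subset _ hj))

/-- The slots covered by tight jobs become fewer as layers are removed. -/
theorem card_peelCover_le (h : FracSchedule J m y) {G : Finset Job} (hG : G ⊆ J)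
    (htight : ∀ j ∈ G, j.window.card ≤ 2 * j.proc) (a n : ℕ) :
    -- Each of the `n` layers from `a` on lies inside `peelCover G a` and covers `peelCover G (a +
    -- n)`; by tightness it brings processing time at least half of what it covers.
    (n : ℝ) * (peelCover G (a + n)).card ≤ 2 * m * (peelCover G a).card := by
  have h1 := h.layers_contribution_le hG (peelCover G a) (Finset.Ico a (a + n))
  have h2 : ∀ i ∈ Finset.Ico a (a + n), ((peelCover G (a + n)).card : ℝ) / 2 ≤
      ∑ j ∈ thin (peel G i),
        (((j.window ∩ peelCover G a).card : ℝ) - ((j.window.card : ℝ) - j.proc)) := by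
    intro i hi
    rw [Finset.mem_Ico] at hi
    have h3 := card_le_sum_thin (peelCover_antitone G hi.2.le)
    have h4 : ∑ j ∈ thin (peel G i), ((j.window ∩ peelCover G (a + n)).card : ℝ) ≤
        ∑ j ∈ thin (peel G i),
        2 * (((j.window ∩ peelCover G a).card : ℝ) - ((j.window.card : ℝ) - j.proc)) := by
      refine Finset.sum_le_sum fun j hj => ?_
      have hj' := thin_subset _ hj
      have h5 : j.window ⊆ peelCover G a :=
        Finset.subset_biUnion_of_mem Job.window (peel_antitone G hi.1 hj')
      have h6 : ((j.window ∩ peelCover G (a + n)).card : ℝ) ≤ j.window.card := by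
        exact_mod_cast Finset.card_le_card Finset.inter_subset_left
      have h7 : (j.window.card : ℝ) ≤ 2 * j.proc := by
        exact_mod_cast htight j (peel_subset G i hj')
      rw [Finset.inter_eq_left.2 h5]
      linarith
    rw [← Finset.mul_sum] at h4
    linarith
  have h3 := (Finset.card_nsmul_le_sum _ _ _ h2).trans h1
  rw [Nat.card_Ico, Nat.add_sub_cancel_left, nsmul_eq_mul] at h3
  linarith

/-- In a feasible instance there are no slots `T` that are covered many times by tight jobs each
of which has a substantial part of its laxity in `T`. -/
theorem not_critical (h : FracSchedule J m y) {G : Finset Job} (hG : G ⊆ J)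
    (htight : ∀ j ∈ G, j.window.card ≤ 2 * j.proc) (hm : 0 < m) {T : Finset ℕ} (hT : T.Nonempty)
    (hcover : ∀ s ∈ T, 300 * m ^ 2 + 1 ≤ (G.filter (s ∈ ·.window)).card)
    (hlax : ∀ j ∈ G, j.window.card ≤ j.proc + (300 * m ^ 2 + 1) * (j.window ∩ T).card) :
    False := by
  -- A layer takes away at most two windows over a slot, and 2(2m + 1 + 144m²) < 300m² + 1.
  have hTsub : T ⊆ peelCover G (2 * m + 1 + 72 * m ^ 2 + 72 * m ^ 2) := by
    intro s hs
    have h1 := hcover s hs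
    have h2 := card_le_card_peel G s (2 * m + 1 + 72 * m ^ 2 + 72 * m ^ 2)
    have h3 : 0 < ((peel G (2 * m + 1 + 72 * m ^ 2 + 72 * m ^ 2)).filter (s ∈ ·.window)).card := by
      nlinarith
    obtain ⟨j, hj⟩ := Finset.card_pos.1 h3
    rw [Finset.mem_filter] at hj
    exact Finset.mem_biUnion.2 ⟨j, hj.1, hj.2⟩
  have hTcard : (T.card : ℝ) ≤ (peelCover G (2 * m + 1 + 72 * m ^ 2 + 72 * m ^ 2)).card := by
    exact_mod_cast Finset.card_le_card hTsub
  have hTpos : (0 : ℝ) < T.card := by exact_mod_cast hT.card_pos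
  have hm1 : (1 : ℝ) ≤ m := by exact_mod_cast hm
  -- Every 72m² layers shrink the cover by a factor 36m. Two such rounds give 1296m², enough for
  -- 4(300m² + 1).
  have halve : ∀ a, 36 * (m : ℝ) * (peelCover G (a + 72 * m ^ 2)).card ≤ (peelCover G a).card := by
    intro a
    have h1 := h.card_peelCover_le hG htight a (72 * m ^ 2)
    push_cast at h1
    refine le_of_mul_le_mul_left ?_ (by linarith : (0 : ℝ) < 2 * m)
    calc _ = _ := by ring
      _ ≤ _ := h1
  set X := peelCover G (2 * m + 1) with hX
  have hbig : 4 * (300 * (m : ℝ) ^ 2 + 1) * T.card ≤ X.card := by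
    have h1 := halve (2 * m + 1)
    have h2 := halve (2 * m + 1 + 72 * m ^ 2)
    have h3 : 36 * (m : ℝ) * (36 * m * T.card) ≤ X.card := by
      refine le_trans (mul_le_mul_of_nonneg_left ?_ (by linarith)) h1
      exact le_trans (mul_le_mul_of_nonneg_left hTcard (by linarith)) h2
    refine le_trans ?_ h3
    have h4 : 4 * (300 * (m : ℝ) ^ 2 + 1) ≤ 36 * m * (36 * m) := by nlinarith
    calc _ ≤ 36 * (m : ℝ) * (36 * m) * T.card := mul_le_mul_of_nonneg_right h4 hTpos.le
      _ = _ := by ring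
  have h1 := h.layers_contribution_le hG X (Finset.range (2 * m + 1))
  -- A layer covers `X`, and meets `T` at most `2 * T.card` times; so its total laxity is at most
  -- half of `X.card` by `hbig`.
  have h2 : ∀ i ∈ Finset.range (2 * m + 1), (X.card : ℝ) / 2 ≤
      ∑ j ∈ thin (peel G i), (((j.window ∩ X).card : ℝ) - ((j.window.card : ℝ) - j.proc)) := by
    intro i hi
    rw [Finset.mem_range] at hi
    have h3 := card_le_sum_thin (peelCover_antitone G hi.le)
    have h4 := sum_thin_le (peel G i) T
    have h5 : ∑ j ∈ thin (peel G i), ((j.window.card : ℝ) - j.proc) ≤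
        (300 * (m : ℝ) ^ 2 + 1) * ∑ j ∈ thin (peel G i), ((j.window ∩ T).card : ℝ) := by
      rw [Finset.mul_sum]
      refine Finset.sum_le_sum fun j hj => ?_
      have h6 : (j.window.card : ℝ) ≤ j.proc + (300 * (m : ℝ) ^ 2 + 1) * (j.window ∩ T).card := by
        exact_mod_cast hlax j (peel_subset G i (thin_subset _ hj))
      linarith
    have h6 := mul_le_mul_of_nonneg_left h4 (by positivity : (0 : ℝ) ≤ 300 * (m : ℝ) ^ 2 + 1)
    rw [Finset.sum_sub_distrib]
    linarith
  have h3 := (Finset.card_nsmul_le_sum _ _ _ h2).trans h1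
  rw [Finset.card_range, nsmul_eq_mul] at h3
  push_cast at h3
  have hXpos : (0 : ℝ) < X.card := lt_of_lt_of_le (by positivity) hbig
  nlinarith

end FracSchedule

/-! ### The blocking rule -/

/-- Greedy: from any `k + 1` remaining jobs in increasing order, block the one of highest rank that
is not full at its rank. All higher ranks are then full, which is what the explanations need later.
The process stops with at most `k` jobs left or at a chain that is full throughout. -/
theorem exists_prune (k : ℕ) (full : Job → Fin (k + 1) → Prop) (A : Finset Job) :
    ∃ V ⊆ A, ∃ β : Job → Fin (k + 1),
      (∀ j ∈ A, j ∉ V → ¬ full j (β j) ∧ ∃ c : Fin (k + 1) → Job, StrictMono c ∧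
        (∀ x, c x ∈ A) ∧ c (β j) = j ∧ ∀ x, β j < x → full (c x) x) ∧
      (V.card ≤ k ∨ ∃ c : Fin (k + 1) → Job, StrictMono c ∧ (∀ x, c x ∈ A) ∧
        ∀ x, full (c x) x) := by
  induction A using Finset.strongInduction with
  | H A ih =>
  rcases Nat.lt_or_ge k A.card with hk | hk
  · obtain ⟨B, hBA, hB⟩ := Finset.exists_subset_card_eq (Nat.succ_le_of_lt hk)
    set c : Fin (k + 1) → Job := fun x => B.orderEmbOfFin hB x
    have hc : StrictMono c := (B.orderEmbOfFin hB).strictMono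
    have hcA : ∀ x, c x ∈ A := fun x => hBA (B.orderEmbOfFin_mem hB x)
    by_cases hall : ∀ x, full (c x) x
    · exact ⟨A, subset_rfl, fun _ => 0, fun j hj hj' => absurd hj hj', Or.inr ⟨c, hc, hcA, hall⟩⟩
    · push Not at hall
      obtain ⟨h, hh, hmax⟩ := Finset.exists_max_image
        (Finset.univ.filter fun x => ¬ full (c x) x) id (by
          obtain ⟨x, hx⟩ := hall
          exact ⟨x, by simp [hx]⟩)
      simp only [Finset.mem_filter, Finset.mem_univ, true_and, id] at hh hmax
      obtain ⟨V, hV, β, hβ, hcase⟩ := ih (A.erase (c h)) (Finset.erase_ssubset (hcA h))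
      have hsub := Finset.erase_subset (c h) A
      refine ⟨V, hV.trans hsub, Function.update β (c h) h, fun j hj hjV => ?_, ?_⟩
      · by_cases hjc : j = c h
        · subst hjc
          rw [Function.update_self]
          refine ⟨hh, c, hc, hcA, rfl, fun x hx => ?_⟩
          by_contra hx'
          exact absurd (hmax x hx') (not_le.2 hx)
        · rw [Function.update_of_ne hjc]
          obtain ⟨h1, c', h2, h3, h4⟩ := hβ j (Finset.mem_erase.2 ⟨hjc, hj⟩) hjV
          exact ⟨h1, c', h2, fun x => hsub (h3 x), h4⟩
      · rcases hcase with hcase | ⟨c', h2, h3, h4⟩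
        · exact Or.inl hcase
        · exact Or.inr ⟨c', h2, fun x => hsub (h3 x), h4⟩
  · exact ⟨A, subset_rfl, fun _ => 0, fun j hj hj' => absurd hj hj', Or.inl hk⟩

/-- The jobs of `A` that are not blocked, where `full j x` says that job `j` may no longer be
blocked at rank `x`. -/
noncomputable def prune (k : ℕ) (full : Job → Fin (k + 1) → Prop) (A : Finset Job) : Finset Job :=
  (exists_prune k full A).choose

/-- The ranks at which the blocked jobs are blocked. -/
noncomputable def pruneRank (k : ℕ) (full : Job → Fin (k + 1) → Prop) (A : Finset Job) :
    Job → Fin (k + 1) :=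
  (exists_prune k full A).choose_spec.2.choose

theorem prune_subset (k : ℕ) (full : Job → Fin (k + 1) → Prop) (A : Finset Job) :
    prune k full A ⊆ A := (exists_prune k full A).choose_spec.1

theorem prune_spec {k : ℕ} {full : Job → Fin (k + 1) → Prop} {A : Finset Job} {j : Job}
    (hj : j ∈ A) (hj' : j ∉ prune k full A) :
    ¬ full j (pruneRank k full A j) ∧ ∃ c : Fin (k + 1) → Job, StrictMono c ∧
      (∀ x, c x ∈ A) ∧ c (pruneRank k full A j) = j ∧
        ∀ x, pruneRank k full A j < x → full (c x) x :=
  (exists_prune k full A).choose_spec.2.choose_spec.1 j hj hj'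

theorem card_prune (k : ℕ) (full : Job → Fin (k + 1) → Prop) (A : Finset Job) :
    (prune k full A).card ≤ k ∨ ∃ c : Fin (k + 1) → Job, StrictMono c ∧ (∀ x, c x ∈ A) ∧
      ∀ x, full (c x) x :=
  (exists_prune k full A).choose_spec.2.choose_spec.2

/-- The number of slots for which a job may be blocked at a given rank. -/
def Job.capacity (k : ℕ) (j : Job) : ℕ := (j.deadline - j.release - j.proc) / (k + 1)

/-- The jobs of `J` that are released by time `n` and have their deadline after time `n`. -/
noncomputable def active (J : Instance) (n : ℕ) : Finset Job :=
  (J.filter (·.release ≤ n)).filter (n < ·.deadline)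

theorem mem_active {J : Instance} {n : ℕ} {j : Job} : j ∈ active J n ↔ j ∈ J ∧ n ∈ j.window := by
  simp [active, Job.mem_window, and_assoc]

/-- The number of slots before slot `n` in which a job has been blocked at a given rank. -/
noncomputable def blockCount (k : ℕ) (J : Instance) : ℕ → Job → Fin (k + 1) → ℕ
  | 0, _, _ => 0
  | n + 1, j, x => blockCount k J n j x +
      if j ∈ active J n ∧
        j ∉ prune k (fun i z => i.capacity k ≤ blockCount k J n i z) (active J n) ∧
        pruneRank k (fun i z => i.capacity k ≤ blockCount k J n i z) (active J n) j = x
      then 1 else 0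

/-- Whether a job has been blocked at rank `x` as often as it may be. -/
def Full (k : ℕ) (J : Instance) (n : ℕ) (j : Job) (x : Fin (k + 1)) : Prop :=
  j.capacity k ≤ blockCount k J n j x

/-- The active jobs that are not blocked in slot `n`. -/
noncomputable def unblocked (k : ℕ) (J : Instance) (n : ℕ) : Finset Job :=
  prune k (Full k J n) (active J n)

/-- Whether job `j` is blocked at rank `x` in slot `n`. -/
def BlockedAt (k : ℕ) (J : Instance) (n : ℕ) (j : Job) (x : Fin (k + 1)) : Prop :=
  j ∈ active J n ∧ j ∉ unblocked k J n ∧ pruneRank k (Full k J n) (active J n) j = x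

/-- Refolds `Full` and `BlockedAt`, which the recursion has to inline because they depend on
`blockCount`. -/
theorem blockCount_succ (k : ℕ) (J : Instance) (n : ℕ) (j : Job) (x : Fin (k + 1)) :
    blockCount k J (n + 1) j x = blockCount k J n j x + if BlockedAt k J n j x then 1 else 0 := by
  rw [blockCount]
  congr

theorem blockCount_eq_card (k : ℕ) (J : Instance) (n : ℕ) (j : Job) (x : Fin (k + 1)) :
    blockCount k J n j x = ((Finset.range n).filter fun s => BlockedAt k J s j x).card := by
  induction n with
  | zero => rfl
  | succ n ih =>
    rw [blockCount_succ, ih, Finset.range_add_one, Finset.filter_insert]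
    split_ifs
    · rw [Finset.card_insert_of_notMem (by simp)]
    · rfl

theorem blockCount_le (k : ℕ) (J : Instance) (n : ℕ) (j : Job) (x : Fin (k + 1)) :
    blockCount k J n j x ≤ j.capacity k := by
  induction n with
  | zero => exact Nat.zero_le _
  | succ n ih =>
    rw [blockCount_succ]
    split_ifs with h
    · have h1 := (prune_spec h.1 h.2.1).1
      rw [h.2.2, Full] at h1
      omega
    · exact ih

theorem unblocked_subset (k : ℕ) (J : Instance) (n : ℕ) : unblocked k J n ⊆ active J n :=
  prune_subset _ _ _

theorem blockCount_congr {k : ℕ} {J J' : Instance} {n : ℕ}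
    (h : ∀ s < n, J.filter (·.release ≤ s) = J'.filter (·.release ≤ s)) :
    blockCount k J n = blockCount k J' n := by
  induction n with
  | zero => rfl
  | succ n ih =>
    ext j x
    simp only [blockCount, active, ih fun s hs => h s (by omega), h n (by omega)]
    congr

theorem unblocked_congr {k : ℕ} {J J' : Instance} {n : ℕ}
    (h : J.filter (·.release ≤ n) = J'.filter (·.release ≤ n)) :
    unblocked k J n = unblocked k J' n := by
  have h1 : blockCount k J n = blockCount k J' n :=
    blockCount_congr fun s hs => filter_release_congr hs.le h
  have h2 : Full k J n = Full k J' n := by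
    ext j x
    rw [Full, Full, h1]
  rw [unblocked, unblocked, h2, active, active, h]

/-- A job is unblocked in as many slots as it needs. -/
theorem proc_le_card_unblocked (k : ℕ) {J : Instance} {j : Job} (hj : j ∈ J)
    (hp : j.proc ≤ j.window.card) :
    j.proc ≤ ((Finset.range j.deadline).filter fun s => j ∈ unblocked k J s).card := by
  -- A slot of the window is either unblocked or blocked at one of `k + 1` ranks, and the budgets of
  -- all ranks together do not exceed the laxity.
  have h1 : j.window ⊆ ((Finset.range j.deadline).filter fun s => j ∈ unblocked k J s) ∪
      Finset.univ.biUnion fun x : Fin (k + 1) =>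
        (Finset.range j.deadline).filter fun s => BlockedAt k J s j x := by
    intro s hs
    have hs' := Finset.mem_range.2 (Job.mem_window.1 hs).2
    by_cases hu : j ∈ unblocked k J s
    · exact Finset.mem_union_left _ (Finset.mem_filter.2 ⟨hs', hu⟩)
    · exact Finset.mem_union_right _ (Finset.mem_biUnion.2 ⟨_, Finset.mem_univ _,
        Finset.mem_filter.2 ⟨hs', mem_active.2 ⟨hj, hs⟩, hu, rfl⟩⟩)
  have h2 := (Finset.card_le_card h1).trans (Finset.card_union_le _ _)
  have h3 : (Finset.univ.biUnion fun x : Fin (k + 1) =>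
      (Finset.range j.deadline).filter fun s => BlockedAt k J s j x).card ≤
      (k + 1) * j.capacity k := by
    refine Finset.card_biUnion_le.trans ?_
    have := Finset.sum_le_card_nsmul Finset.univ (fun x : Fin (k + 1) =>
      ((Finset.range j.deadline).filter fun s => BlockedAt k J s j x).card) (j.capacity k)
      fun x _ => by rw [← blockCount_eq_card]; exact blockCount_le k J _ j x
    simpa using this
  have h4 : (k + 1) * j.capacity k ≤ j.deadline - j.release - j.proc := Nat.mul_div_le _ _
  have h5 : j.window.card = j.deadline - j.release := Nat.card_Ico _ _
  omega

/-! ### Explanations of a failure of blocking -/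

/-- The slots and chains of jobs that explain why too many jobs are unblocked in slot `n`: in slot
`s`, all jobs of the chain `e` are active, and those of rank at least `g` are full. -/
inductive Explains (k : ℕ) (J : Instance) (n : ℕ) : ℕ → (Fin (k + 1) → Job) → ℕ → Prop
  | base {c : Fin (k + 1) → Job} (hc : StrictMono c) (hact : ∀ x, c x ∈ active J n)
      (hfull : ∀ x, Full k J n (c x) x) : Explains k J n n c 0
  -- Here `s'` is a slot where `e x` was blocked at rank `x`, with witness chain `c`. The new chain
  -- keeps `e` below `x`; only ranks above `x` are known to be full, as `c x` was still below its
  -- budget in `s'`.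
  | step {s s' g : ℕ} {e c : Fin (k + 1) → Job} {x : Fin (k + 1)} (he : Explains k J n s e g)
      (hx : g ≤ x) (hs : s' < s) (hc : StrictMono c) (hact : ∀ z, c z ∈ active J s')
      (hcx : c x = e x) (hfull : ∀ z, x < z → Full k J s' (c z) z) :
      Explains k J n s' (fun z => if z < x then e z else c z) (x + 1)

namespace Explains

variable {k : ℕ} {J : Instance} {n s g : ℕ} {e : Fin (k + 1) → Job}

/-- The order by release date is used here: the jobs of `e` below rank `x` are released no later
than `e x`, so they are already active in `s'`, and they stay active until `s > s'`. -/
theorem invariant (h : Explains k J n s e g) :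
    s ≤ n ∧ StrictMono e ∧ (∀ x, e x ∈ active J s) ∧
      ∀ x : Fin (k + 1), g ≤ x → Full k J s (e x) x := by
  induction h with
  | base hc hact hfull => exact ⟨le_rfl, hc, hact, fun x _ => hfull x⟩
  | @step s s' g e c x he hx hs hc hact hcx hfull ih =>
    obtain ⟨hsn, hmono, hactive, _⟩ := ih
    refine ⟨hs.le.trans hsn, ?_, ?_, ?_⟩
    · intro z w hzw
      dsimp only
      split_ifs with hz hw hw
      · exact hmono hzw
      · calc e z < e x := hmono hz
          _ = c x := hcx.symm
          _ ≤ c w := hc.monotone (not_lt.1 hw)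
      · exact absurd (hzw.trans hw) hz
      · exact hc hzw
    · intro z
      dsimp only
      split_ifs with hz
      · have h1 := mem_active.1 (hactive z)
        have h2 := mem_active.1 (hact x)
        rw [hcx] at h2
        have h3 := Job.release_le_of_lt (hmono hz)
        rw [Job.mem_window] at h1 h2
        exact mem_active.2 ⟨h1.1, Job.mem_window.2 ⟨by omega, by omega⟩⟩
      · exact hact z
    · intro z hz
      have hxz : x < z := Fin.lt_def.2 (by omega)
      dsimp only
      rw [if_neg (not_lt.2 hxz.le)]
      exact hfull z hxz

/-- Each slot in which the rank `x` job of an explanation was blocked at rank `x` is explained. -/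
theorem exists_of_blockedAt (h : Explains k J n s e g) {x : Fin (k + 1)} (hx : g ≤ x) {s' : ℕ}
    (hs : s' < s) (hb : BlockedAt k J s' (e x) x) : ∃ e' g', Explains k J n s' e' g' := by
  obtain ⟨h1, h2, h3⟩ := hb
  obtain ⟨-, c, hc, hact, hcx, hfull⟩ := prune_spec h1 h2
  rw [h3] at hcx hfull
  exact ⟨_, _, h.step hx hs hc hact hcx hfull⟩

end Explains

/-- The slots that occur in explanations. -/
noncomputable def explainedSlots (k : ℕ) (J : Instance) (n : ℕ) : Finset ℕ :=
  (Finset.range (n + 1)).filter fun s => ∃ e g, Explains k J n s e g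

theorem Explains.mem_slots {k : ℕ} {J : Instance} {n s g : ℕ} {e : Fin (k + 1) → Job}
    (h : Explains k J n s e g) : s ∈ explainedSlots k J n :=
  Finset.mem_filter.2 ⟨Finset.mem_range.2 (by have := h.invariant.1; omega), e, g, h⟩

/-- At a full rank, the slots that used up the budget are all explained, and the current slot is one
more. At the other ranks the job is inherited from the explanation one step before, so induction
applies. -/
theorem Explains.capacity_lt {k : ℕ} {J : Instance} {n s g : ℕ} {e : Fin (k + 1) → Job}
    (h : Explains k J n s e g) (x : Fin (k + 1)) :
    (e x).capacity k < ((e x).window ∩ explainedSlots k J n).card := by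
  have direct : ∀ {s g : ℕ} {e : Fin (k + 1) → Job}, Explains k J n s e g → ∀ x : Fin (k + 1),
      g ≤ x → (e x).capacity k < ((e x).window ∩ explainedSlots k J n).card := by
    intro s g e h x hx
    have h1 := h.invariant.2.2.2 x hx
    rw [Full, blockCount_eq_card] at h1
    have h2 : insert s ((Finset.range s).filter fun s' => BlockedAt k J s' (e x) x) ⊆
        (e x).window ∩ explainedSlots k J n := by
      intro s' hs'
      rw [Finset.mem_insert, Finset.mem_filter, Finset.mem_range] at hs'
      rcases hs' with rfl | ⟨hs', hb⟩
      · exact Finset.mem_inter.2 ⟨(mem_active.1 (h.invariant.2.2.1 x)).2, h.mem_slots⟩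
      · obtain ⟨e', g', h'⟩ := h.exists_of_blockedAt hx hs' hb
        exact Finset.mem_inter.2 ⟨(mem_active.1 hb.1).2, h'.mem_slots⟩
    have h3 := Finset.card_le_card h2
    rw [Finset.card_insert_of_notMem (by simp)] at h3
    omega
  induction h generalizing x with
  | base hc hact hfull => exact direct (.base hc hact hfull) x (Nat.zero_le _)
  | @step s s' g e c w he hw hs hc hact hcw hfull ih =>
    rcases lt_or_ge w x with hwx | hwx
    · exact direct (he.step hw hs hc hact hcw hfull) x (Nat.succ_le_of_lt hwx)
    · have : (fun z => if z < w then e z else c z) x = e x := by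
        rcases hwx.lt_or_eq with hlt | rfl
        · simp [hlt]
        · simp [hcw]
      rw [this]
      exact ih x

/-- If all jobs are tight, then few jobs are unblocked at any time. -/
theorem card_unblocked_le {J : Instance} {m : ℕ} {y : Job → ℕ → ℝ} (h : FracSchedule J m y)
    (hpos : ∀ j ∈ J, 0 < j.proc) (htight : ∀ j ∈ J, j.window.card ≤ 2 * j.proc) (n : ℕ) :
    (unblocked (300 * m ^ 2) J n).card ≤ 300 * m ^ 2 := by
  rcases card_prune (300 * m ^ 2) (Full _ J n) (active J n) with hle | ⟨c, hc, hact, hfull⟩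
  · exact hle
  exfalso
  have h0 : Explains (300 * m ^ 2) J n n c 0 := .base hc hact hfull
  have hm : 0 < m := by
    by_contra hm
    have hj := (mem_active.1 (hact 0)).1
    have h1 := h.sum_load_le (Finset.singleton_subset_iff.2 hj) (c 0).window
    rw [Finset.sum_singleton, h.total _ hj] at h1
    have h2 : (0 : ℝ) < (c 0).proc := by exact_mod_cast hpos _ hj
    have h3 : (m : ℝ) = 0 := by exact_mod_cast Nat.eq_zero_of_not_pos hm
    have h4 : (m : ℝ) * (c 0).window.card = 0 := by rw [h3, zero_mul]
    linarith
  -- The critical configuration: all explained slots, and all jobs that occur in explaining chains.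
  refine h.not_critical (G := J.filter fun j =>
    ∃ s e g x, Explains (300 * m ^ 2) J n s e g ∧ e x = j) (Finset.filter_subset _ _)
    (fun j hj => htight j (Finset.mem_filter.1 hj).1) hm (T := explainedSlots (300 * m ^ 2) J n)
    ⟨n, h0.mem_slots⟩ ?_ ?_
  · intro s hs
    obtain ⟨-, e, g, he⟩ := Finset.mem_filter.1 hs
    have hinv := he.invariant
    have hcard := Finset.card_image_of_injective Finset.univ hinv.2.1.injective
    rw [Finset.card_univ, Fintype.card_fin] at hcard
    refine hcard.symm.le.trans (Finset.card_le_card fun j hj => ?_)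
    obtain ⟨x, -, rfl⟩ := Finset.mem_image.1 hj
    have hx := mem_active.1 (hinv.2.2.1 x)
    exact Finset.mem_filter.2 ⟨Finset.mem_filter.2 ⟨hx.1, s, e, g, x, he, rfl⟩, hx.2⟩
  · intro j hj
    obtain ⟨-, s, e, g, x, he, rfl⟩ := Finset.mem_filter.1 hj
    have h1 := he.capacity_lt x
    rw [Job.capacity, Nat.div_lt_iff_lt_mul (Nat.succ_pos _)] at h1
    have h2 : (e x).window.card = (e x).deadline - (e x).release := Nat.card_Ico _ _
    rw [mul_comm, Nat.succ_eq_add_one] at h1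
    omega

/-! ### Unknown optimum: job classes and the online rule -/

/-- The least number of machines for which an instance has a fractional schedule. -/
noncomputable def fracOpt (J : Instance) : ℕ := sInf {m | ∃ y, FracSchedule J m y}

theorem fracOpt_le {J : Instance} {m : ℕ} (h : ∃ y, FracSchedule J m y) : fracOpt J ≤ m :=
  Nat.sInf_le h

theorem exists_fracSchedule_fracOpt {J : Instance} {m : ℕ} (h : ∃ y, FracSchedule J m y) :
    ∃ y, FracSchedule J (fracOpt J) y :=
  Nat.sInf_mem (s := {m | ∃ y, FracSchedule J m y}) ⟨m, h⟩

/-- The class of a job: the optimum of the instance as known at the release of the job. -/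
noncomputable def jobClass (J : Instance) (j : Job) : ℕ :=
  fracOpt (J.filter (·.release ≤ j.release))

theorem jobClass_le {J : Instance} {m : ℕ} {y : Job → ℕ → ℝ} (h : FracSchedule J m y) (j : Job) :
    jobClass J j ≤ m := fracOpt_le ⟨y, h.subset (Finset.filter_subset _ _)⟩

/-- When the last job of the class is released, the known instance contains the whole class and has
fractional optimum `i`. -/
theorem exists_fracSchedule_of_jobClass_eq {J S : Instance} {m i : ℕ} {y : Job → ℕ → ℝ}
    (h : FracSchedule J m y) (hS : S ⊆ J) (hi : ∀ j ∈ S, jobClass J j = i) :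
    ∃ y, FracSchedule S i y := by
  rcases S.eq_empty_or_nonempty with rfl | hne
  · exact ⟨fun _ _ => 0, by simp, by simp, by simp, by simp, by simp⟩
  · obtain ⟨j, hj, hmax⟩ := Finset.exists_max_image S Job.release hne
    obtain ⟨z, hz⟩ := exists_fracSchedule_fracOpt (J := J.filter (·.release ≤ j.release))
      ⟨y, h.subset (Finset.filter_subset _ _)⟩
    have : fracOpt (J.filter (·.release ≤ j.release)) = i := hi j hj
    rw [this] at hz
    exact ⟨z, hz.subset fun j' hj' => Finset.mem_filter.2 ⟨hS hj', hmax j' hj'⟩⟩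

/-- The loose jobs of class `i`. -/
noncomputable def looseJobs (J : Instance) (i : ℕ) : Instance :=
  J.filter fun j => 0 < j.proc ∧ j.release + 2 * j.proc ≤ j.deadline ∧ jobClass J j = i

/-- The tight jobs of class `i`. -/
noncomputable def tightJobs (J : Instance) (i : ℕ) : Instance :=
  J.filter fun j => 0 < j.proc ∧ j.deadline < j.release + 2 * j.proc ∧ jobClass J j = i

/-- The unblocked tight jobs of class `i` that have not been finished before slot `n`. -/
noncomputable def tightRun (J : Instance) (i n : ℕ) : Finset Job :=
  (unblocked (300 * i ^ 2) (tightJobs J i) n).filter fun j =>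
    ((Finset.range n).filter fun s => j ∈ unblocked (300 * i ^ 2) (tightJobs J i) s).card < j.proc

/-- The jobs that the online algorithm processes in slot `n`. -/
noncomputable def onlineRun (J : Instance) (n : ℕ) : Finset Job :=
  J.filter fun j => j ∈ edf (20 * jobClass J j) (looseJobs J (jobClass J j)) n ∨
    j ∈ tightRun J (jobClass J j) n

theorem jobClass_congr {J J' : Instance} {n : ℕ}
    (h : J.filter (·.release ≤ n) = J'.filter (·.release ≤ n)) {j : Job} (hj : j.release ≤ n) :
    jobClass J j = jobClass J' j := by
  rw [jobClass, jobClass, filter_release_congr hj h]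

theorem filter_filter_congr {J J' : Instance} {n : ℕ}
    (h : J.filter (·.release ≤ n) = J'.filter (·.release ≤ n)) {p p' : Job → Prop}
    [DecidablePred p] [DecidablePred p']
    (hp : ∀ j, j.release ≤ n → (p j ↔ p' j)) :
    (J.filter p).filter (·.release ≤ n) = (J'.filter p').filter (·.release ≤ n) := by
  rw [Finset.filter_comm, h, Finset.filter_comm]
  ext j
  simp only [Finset.mem_filter]
  constructor
  · exact fun hj => ⟨⟨hj.1.1, (hp j hj.2).1 hj.1.2⟩, hj.2⟩
  · exact fun hj => ⟨⟨hj.1.1, (hp j hj.2).2 hj.1.2⟩, hj.2⟩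

theorem looseJobs_congr {J J' : Instance} {n : ℕ}
    (h : J.filter (·.release ≤ n) = J'.filter (·.release ≤ n)) (i : ℕ) :
    (looseJobs J i).filter (·.release ≤ n) = (looseJobs J' i).filter (·.release ≤ n) := by
  unfold looseJobs
  exact filter_filter_congr h fun j hj => by rw [jobClass_congr h hj]

theorem tightJobs_congr {J J' : Instance} {n : ℕ}
    (h : J.filter (·.release ≤ n) = J'.filter (·.release ≤ n)) (i : ℕ) :
    (tightJobs J i).filter (·.release ≤ n) = (tightJobs J' i).filter (·.release ≤ n) := by
  unfold tightJobs
  exact filter_filter_congr h fun j hj => by rw [jobClass_congr h hj]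

theorem tightRun_congr {J J' : Instance} {n : ℕ}
    (h : J.filter (·.release ≤ n) = J'.filter (·.release ≤ n)) (i : ℕ) :
    tightRun J i n = tightRun J' i n := by
  have h1 : ∀ s ≤ n, unblocked (300 * i ^ 2) (tightJobs J i) s =
      unblocked (300 * i ^ 2) (tightJobs J' i) s := fun s hs =>
    unblocked_congr (tightJobs_congr (filter_release_congr hs h) i)
  rw [tightRun, tightRun, h1 n le_rfl]
  refine Finset.filter_congr fun j _ => ?_
  rw [Finset.filter_congr fun s hs => by rw [h1 s (Finset.mem_range.1 hs).le]]

theorem mem_edf_looseJobs {J : Instance} {i n k : ℕ} {j : Job} (h : j ∈ edf k (looseJobs J i) n) :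
    j ∈ J ∧ j.release ≤ n ∧ j.release + 2 * j.proc ≤ j.deadline ∧ jobClass J j = i := by
  have h1 := mem_edf h
  have h2 := Finset.mem_filter.1 h1.1
  exact ⟨h2.1, h1.2.1, h2.2.2⟩

theorem mem_tightRun {J : Instance} {i n : ℕ} {j : Job} (h : j ∈ tightRun J i n) :
    j ∈ J ∧ n ∈ j.window ∧ j.deadline < j.release + 2 * j.proc ∧ jobClass J j = i := by
  have h1 := mem_active.1 (unblocked_subset _ _ _ (Finset.mem_filter.1 h).1)
  have h2 := Finset.mem_filter.1 h1.1
  exact ⟨h2.1, h1.2, h2.2.2⟩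

theorem onlineRun_congr {J J' : Instance} {n : ℕ}
    (h : J.filter (·.release ≤ n) = J'.filter (·.release ≤ n)) :
    onlineRun J n = onlineRun J' n := by
  have key : ∀ {J J' : Instance}, J.filter (·.release ≤ n) = J'.filter (·.release ≤ n) →
      onlineRun J n ⊆ onlineRun J' n := by
    intro J J' h j hj
    obtain ⟨hjJ, hj⟩ := Finset.mem_filter.1 hj
    have hr : j.release ≤ n := by
      rcases hj with hj | hj
      · exact (mem_edf_looseJobs hj).2.1
      · exact (Job.mem_window.1 (mem_tightRun hj).2.1).1
    have hjJ' : j ∈ J' := by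
      have : j ∈ J'.filter (·.release ≤ n) := h ▸ Finset.mem_filter.2 ⟨hjJ, hr⟩
      exact (Finset.mem_filter.1 this).1
    refine Finset.mem_filter.2 ⟨hjJ', ?_⟩
    rw [← jobClass_congr h hr, ← tightRun_congr h]
    refine hj.imp_left fun hj => ?_
    rwa [← edf_congr (looseJobs_congr h _)]
  exact (key h).antisymm (key h.symm)

/-- A job that runs in unblocked slots until it is finished gets exactly `p` of them if there are
enough. -/
theorem card_filter_lt (P : ℕ → Prop) [DecidablePred P] (p N : ℕ) :
    ((Finset.range N).filter fun s => P s ∧ ((Finset.range s).filter P).card < p).card =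
      min p ((Finset.range N).filter P).card := by
  induction N with
  | zero => simp
  | succ N ih =>
    rw [Finset.range_add_one, Finset.filter_insert, Finset.filter_insert]
    by_cases hP : P N
    · rw [if_pos hP, Finset.card_insert_of_notMem (by simp)]
      by_cases hc : ((Finset.range N).filter P).card < p
      · rw [if_pos ⟨hP, hc⟩, Finset.card_insert_of_notMem (by simp), ih]
        omega
      · rw [if_neg fun h => hc h.2, ih]
        omega
    · rw [if_neg fun h => hP h.1, if_neg hP, ih]

section Feasible

variable {J : Instance} {m : ℕ} {y : Job → ℕ → ℝ}

theorem edfDone_looseJobs (h : FracSchedule J m y) {i : ℕ} {j : Job} (hj : j ∈ looseJobs J i) :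
    edfDone (20 * i) (looseJobs J i) j.deadline j = j.proc := by
  obtain ⟨z, hz⟩ := exists_fracSchedule_of_jobClass_eq (S := looseJobs J i) h
    (Finset.filter_subset _ _) fun j hj => (Finset.mem_filter.1 hj).2.2.2
  exact edf_finishes hz (fun j hj => (Finset.mem_filter.1 hj).2.2.1) hj

theorem mem_window_of_mem_onlineRun (h : FracSchedule J m y) {n : ℕ} {j : Job}
    (hj : j ∈ onlineRun J n) : n ∈ j.window := by
  rcases (Finset.mem_filter.1 hj).2 with hj | hj
  · refine Job.mem_window.2 ⟨(mem_edf_looseJobs hj).2.1, ?_⟩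
    have h1 := mem_edf hj
    -- EDF itself ignores whether deadlines have passed; a late run is impossible because the job is
    -- finished by its deadline.
    by_contra hn
    have h2 := edfDone_mono (k := 20 * jobClass J j) (J := looseJobs J (jobClass J j)) (j := j)
      (not_lt.1 hn)
    have h3 := edfDone_looseJobs h h1.1
    dsimp only at h2
    omega
  · exact (mem_tightRun hj).2.1

theorem card_slots_onlineRun (h : FracSchedule J m y) {j : Job} (hj : j ∈ J) :
    ((Finset.range j.deadline).filter fun n => j ∈ onlineRun J n).card = j.proc := by
  rcases Nat.eq_zero_or_pos j.proc with h0 | hpos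
  · rw [h0, Finset.card_eq_zero, Finset.filter_eq_empty_iff]
    intro n _ hn
    rcases (Finset.mem_filter.1 hn).2 with hn | hn
    · have := (mem_edf hn).2.2
      omega
    · have := (Finset.mem_filter.1 hn).2
      omega
  rcases Nat.lt_or_ge j.deadline (j.release + 2 * j.proc) with ht | hl
  · have hjt : j ∈ tightJobs J (jobClass J j) := Finset.mem_filter.2 ⟨hj, hpos, ht, rfl⟩
    have h1 : ∀ n, j ∈ onlineRun J n ↔ j ∈ tightRun J (jobClass J j) n := by
      intro n
      refine ⟨fun hn => ((Finset.mem_filter.1 hn).2).resolve_left fun hn' => ?_, fun hn =>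
        Finset.mem_filter.2 ⟨hj, Or.inr hn⟩⟩
      have := (mem_edf_looseJobs hn').2.2.1
      omega
    have h2 := card_filter_lt (fun s => j ∈ unblocked (300 * jobClass J j ^ 2)
      (tightJobs J (jobClass J j)) s) j.proc j.deadline
    rw [min_eq_left (proc_le_card_unblocked _ hjt (h.proc_le_card hj))] at h2
    rw [← h2]
    refine congrArg Finset.card (Finset.filter_congr fun n _ => ?_)
    rw [h1, tightRun, Finset.mem_filter]
  · have hjl : j ∈ looseJobs J (jobClass J j) := Finset.mem_filter.2 ⟨hj, hpos, hl, rfl⟩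
    rw [← edfDone_looseJobs h hjl, edfDone_eq_card]
    refine congrArg Finset.card (Finset.filter_congr fun n _ => ?_)
    refine ⟨fun hn => ((Finset.mem_filter.1 hn).2).resolve_right fun hn' => ?_, fun hn =>
      Finset.mem_filter.2 ⟨hj, Or.inl hn⟩⟩
    have := (mem_tightRun hn').2.2.1
    omega

theorem card_onlineRun_le (h : FracSchedule J m y) (n : ℕ) :
    (onlineRun J n).card ≤ 640 * m ^ 3 := by
  have h1 : onlineRun J n ⊆ (Finset.range (m + 1)).biUnion fun i =>
      edf (20 * i) (looseJobs J i) n ∪ unblocked (300 * i ^ 2) (tightJobs J i) n := by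
    intro j hj
    refine Finset.mem_biUnion.2 ⟨jobClass J j,
      Finset.mem_range.2 (Nat.lt_succ_of_le (jobClass_le h j)), ?_⟩
    rcases (Finset.mem_filter.1 hj).2 with hj | hj
    · exact Finset.mem_union_left _ hj
    · exact Finset.mem_union_right _ (Finset.mem_filter.1 hj).1
  have h2 : ∀ i ∈ Finset.range (m + 1), (edf (20 * i) (looseJobs J i) n ∪
      unblocked (300 * i ^ 2) (tightJobs J i) n).card ≤ 20 * m + 300 * m ^ 2 := by
    intro i hi
    have him : i ≤ m := Nat.lt_succ_iff.1 (Finset.mem_range.1 hi)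
    obtain ⟨z, hz⟩ := exists_fracSchedule_of_jobClass_eq (S := tightJobs J i) h
      (Finset.filter_subset _ _) fun j hj => (Finset.mem_filter.1 hj).2.2.2
    have h3 := card_unblocked_le hz (fun j hj => (Finset.mem_filter.1 hj).2.1) (fun j hj => by
      have h4 := (Finset.mem_filter.1 hj).2.2.1
      have h5 : j.window.card = j.deadline - j.release := Nat.card_Ico _ _
      omega) n
    have h4 : (edf (20 * i) (looseJobs J i) n).card ≤ 20 * i := card_earliest_le _ _
    have h5 : i ^ 2 ≤ m ^ 2 := Nat.pow_le_pow_left him 2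
    have h6 := Finset.card_union_le (edf (20 * i) (looseJobs J i) n)
      (unblocked (300 * i ^ 2) (tightJobs J i) n)
    omega
  have h3 := ((Finset.card_le_card h1).trans Finset.card_biUnion_le).trans
    (Finset.sum_le_card_nsmul _ _ _ h2)
  rw [Finset.card_range, smul_eq_mul] at h3
  refine h3.trans ?_
  rcases Nat.eq_zero_or_pos m with rfl | hm
  · simp
  -- There are m + 1 classes with at most 20m + 300m² jobs each, and (m + 1)(20m + 300m²) ≤ 2m ·
  -- 320m².
  · have h4 : m + 1 ≤ 2 * m := by omega
    have h5 : 20 * m + 300 * m ^ 2 ≤ 320 * m ^ 2 := by nlinarith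
    calc _ ≤ 2 * m * (320 * m ^ 2) := Nat.mul_le_mul h4 h5
      _ = 640 * m ^ 3 := by ring

end Feasible

/-! ### From slots to real time -/

/-- The schedule that processes the jobs of `R n` in slot `n`. -/
noncomputable def slotSchedule (R : ℕ → Finset Job) : Schedule := fun i t =>
  -- The natural floor sends negative times to slot 0, so they are excluded by hand.
  if t < 0 then none else (R ⌊t⌋₊).toList[i]?

theorem slotSchedule_eq_some {R : ℕ → Finset Job} {i : ℕ} {t : ℝ} {j : Job}
    (h : slotSchedule R i t = some j) : 0 ≤ t ∧ (R ⌊t⌋₊).toList[i]? = some j ∧ j ∈ R ⌊t⌋₊ := by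
  rw [slotSchedule] at h
  split_ifs at h with ht
  exact ⟨not_lt.1 ht, h, Finset.mem_toList.1 (List.mem_of_getElem? h)⟩

theorem runTimes_slotSchedule {R : ℕ → Finset Job} {j : Job} {d : ℕ}
    (hd : ∀ n, j ∈ R n → n < d) : (slotSchedule R).runTimes j =
      ⋃ n ∈ (Finset.range d).filter (fun n => j ∈ R n), Set.Ico (n : ℝ) (n + 1) := by
  ext t
  simp only [Schedule.runTimes, Set.mem_ofPred_eq, Set.mem_iUnion, Finset.mem_filter,
    Finset.mem_range, exists_prop]
  constructor
  · rintro ⟨i, hi⟩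
    obtain ⟨ht, -, hj⟩ := slotSchedule_eq_some hi
    exact ⟨⌊t⌋₊, ⟨hd _ hj, hj⟩, Nat.floor_le ht, Nat.lt_floor_add_one t⟩
  · rintro ⟨n, ⟨-, hj⟩, hn⟩
    have ht : 0 ≤ t := (Nat.cast_nonneg n).trans hn.1
    have hfl : ⌊t⌋₊ = n := (Nat.floor_eq_iff ht).2 hn
    obtain ⟨i, hi⟩ := List.mem_iff_getElem?.1 (Finset.mem_toList.2 hj)
    exact ⟨i, by rw [slotSchedule, if_neg (not_lt.2 ht), hfl, hi]⟩

theorem isFeasible_slotSchedule {J : Instance} {k : ℕ} {R : ℕ → Finset Job}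
    (hJ : ∀ n, R n ⊆ J) (hw : ∀ n, ∀ j ∈ R n, n ∈ j.window) (hk : ∀ n, (R n).card ≤ k)
    (hp : ∀ j ∈ J, ((Finset.range j.deadline).filter fun n => j ∈ R n).card = j.proc) :
    IsFeasible J k (slotSchedule R) where
  machines i t hi := by
    rw [slotSchedule]
    split_ifs
    · rfl
    · exact List.getElem?_eq_none (by rw [Finset.length_toList]; exact (hk _).trans hi)
  mem i t j h := hJ _ (slotSchedule_eq_some h).2.2
  window i t j h := by
    obtain ⟨ht, -, hj⟩ := slotSchedule_eq_some h
    obtain ⟨h1, h2⟩ := Job.mem_window.1 (hw _ j hj)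
    exact ⟨(Nat.le_floor_iff ht).1 h1, (Nat.floor_lt ht).1 h2⟩
  no_parallel i i' t j h h' := by
    have h1 := (slotSchedule_eq_some h).2.1
    have h2 := (slotSchedule_eq_some h').2.1
    obtain ⟨hlt, -⟩ := List.getElem?_eq_some_iff.1 h1
    exact (List.getElem?_inj hlt (Finset.nodup_toList _)).1 (h1.trans h2.symm)
  breakpoints := by
    -- Integers up to the last deadline suffice as breakpoints, since all later slots are empty; 0
    -- separates off the negative times.
    refine ⟨(Finset.range (J.sup Job.deadline + 1)).image ((↑) : ℕ → ℝ), ?_⟩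
    have hempty : ∀ n, J.sup Job.deadline ≤ n → R n = ∅ := by
      intro n hn
      refine Finset.eq_empty_iff_forall_notMem.2 fun j hj => ?_
      have h1 := (Job.mem_window.1 (hw n j hj)).2
      have h2 : j.deadline ≤ J.sup Job.deadline := Finset.le_sup (hJ n hj)
      omega
    intro i s t hst hP
    have hP' : ∀ n : ℕ, n ≤ J.sup Job.deadline → ¬ (s < n ∧ (n : ℝ) ≤ t) := fun n hn =>
      hP n (Finset.mem_image.2 ⟨n, Finset.mem_range.2 (Nat.lt_succ_of_le hn), rfl⟩)
    rcases lt_or_ge t 0 with ht | ht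
    · rw [slotSchedule, slotSchedule, if_pos ht, if_pos (hst.trans_lt ht)]
    rcases lt_or_ge s 0 with hs | hs
    · exact absurd ⟨by simpa using hs, by simpa using ht⟩ (hP' 0 (Nat.zero_le _))
    rw [slotSchedule, slotSchedule, if_neg (not_lt.2 ht), if_neg (not_lt.2 hs)]
    rcases (Nat.floor_mono hst).eq_or_lt with hfl | hfl
    · rw [hfl]
    · have h1 : J.sup Job.deadline ≤ ⌊s⌋₊ := by
        by_contra hcon
        refine hP' (⌊s⌋₊ + 1) (by omega) ⟨?_, ?_⟩
        · push_cast
          exact Nat.lt_floor_add_one s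
        · exact (Nat.le_floor_iff ht).1 hfl
      rw [hempty _ h1, hempty _ (h1.trans hfl.le)]
  processed j hj := by
    rw [runTimes_slotSchedule fun n hn => (Job.mem_window.1 (hw n j hn)).2,
      measure_biUnion_finset]
    · simp [hp j hj]
    · intro a _ b _ hab
      refine Set.disjoint_left.2 fun t ha hb => hab ?_
      have h1 : (a : ℝ) < b + 1 := ha.1.trans_lt hb.2
      have h2 : (b : ℝ) < a + 1 := hb.1.trans_lt ha.2
      have h3 : a < b + 1 := by exact_mod_cast h1
      have h4 : b < a + 1 := by exact_mod_cast h2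
      omega
    · exact fun n _ => measurableSet_Ico

/-- The online algorithm: tight and loose jobs are dealt with separately, and so are jobs for which
the optima of the instance known at their releases differ. -/
noncomputable def onlineAlgorithm : OnlineAlgorithm where
  schedule J := slotSchedule (onlineRun J)
  online J J' t h i := by
    rw [slotSchedule, slotSchedule]
    split_ifs with ht
    · rfl
    · rw [onlineRun_congr (n := ⌊t⌋₊)]
      ext j
      have := Finset.ext_iff.1 h j
      simp only [releasedBy, Finset.mem_filter] at this
      simpa only [Finset.mem_filter, Nat.le_floor_iff (not_lt.1 ht)] using this

theorem isFeasible_onlineAlgorithm {J : Instance} {m : ℕ} (h : IsOptimum J m) :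
    IsFeasible J (640 * m ^ 3) (onlineAlgorithm.schedule J) := by
  obtain ⟨σ, hσ⟩ := h.1
  obtain ⟨y, hy⟩ := hσ.exists_fracSchedule
  exact isFeasible_slotSchedule (fun n => Finset.filter_subset _ _)
    (fun n j hj => mem_window_of_mem_onlineRun hy hj) (card_onlineRun_le hy)
    fun j hj => card_slots_onlineRun hy hj

end MachineMinimization

theorem mainTheorem1 :
    ∃ A : MachineMinimization.OnlineAlgorithm,
      (∃ ρ : ℕ → ℝ,
        ρ =O[atTop] (fun m : ℕ => (m : ℝ) ^ 2 * Real.log (m : ℝ)) ∧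
        ∀ (J : MachineMinimization.Instance) (m : ℕ), MachineMinimization.IsOptimum J m →
          ∃ k : ℕ, MachineMinimization.IsFeasible J k (A.schedule J) ∧
            (k : ℝ) ≤ ρ m * (m : ℝ)) ∧
      (∀ M : ℕ, ∃ c : ℝ,
        ∀ (J : MachineMinimization.Instance) (m : ℕ), MachineMinimization.IsOptimum J m → m ≤ M →
          ∃ k : ℕ, MachineMinimization.IsFeasible J k (A.schedule J) ∧
            (k : ℝ) ≤ c * (m : ℝ)) := by
  refine ⟨MachineMinimization.onlineAlgorithm, ⟨fun m => 640 * (m : ℝ) ^ 2, ?_, ?_⟩, ?_⟩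
  · refine IsBigO.of_bound 640 ?_
    -- The logarithm is pure slack: it is eventually at least 1.
    have hlog : ∀ᶠ m : ℕ in atTop, (1 : ℝ) ≤ Real.log m :=
      (Real.tendsto_log_atTop.comp tendsto_natCast_atTop_atTop).eventually_ge_atTop 1
    filter_upwards [hlog] with m hm
    rw [Real.norm_of_nonneg (by positivity), Real.norm_of_nonneg (by positivity)]
    have : (0 : ℝ) ≤ (m : ℝ) ^ 2 := by positivity
    nlinarith
  · intro J m h
    refine ⟨_, MachineMinimization.isFeasible_onlineAlgorithm h, le_of_eq ?_⟩
    push_cast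
    ring
  · intro M
    refine ⟨640 * (M : ℝ) ^ 2, fun J m h hm => ?_⟩
    refine ⟨_, MachineMinimization.isFeasible_onlineAlgorithm h, ?_⟩
    have h1 : (m : ℝ) ^ 2 ≤ (M : ℝ) ^ 2 :=
      pow_le_pow_left₀ (Nat.cast_nonneg m) (by exact_mod_cast hm) 2
    push_cast
    calc 640 * (m : ℝ) ^ 3 = 640 * (m : ℝ) ^ 2 * m := by ring
      _ ≤ 640 * (M : ℝ) ^ 2 * m := by gcongr
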